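/- Let $f:\mathbb R^p\times\mathbb R^q\to\mathbb R$ be a $C^4$ function whose derivatives of orders $1,\dots,4$ are bounded, let $\beta\in(-1,1)$ and let $T>0$ be a finite time horizon. For a step size $h>0$, call $(x_n,y_n)_{n\ge -1}$ a Sim-HB trajectory if for all $n\ge 0$ $$x_{n+1}=x_n-h\nabla_xf(x_n,y_n)+\beta(x_n-x_{n-1}),\qquad y_{n+1}=y_n+h\nabla_yf(x_n,y_n)+\beta(y_n-y_{n-1}),$$ and an Alt-HB trajectory if the same holds with $\nabla_yf(x_{n+1},y_n)$ in place of $\nabla_yf(x_n,y_n)$. Put $$\mathcal F(x,y)=\frac{1}{1-\beta}f(x,y)+\frac{h(1+\beta)}{4(1-\beta)^3}\left(\|\nabla_xf(x,y)\|^2-\|\nabla_yf(x,y)\|^2\right).$$ Continuous Sim-HB is the system $\dot x=-\nabla_x\mathcal F(x,y)$, $\dot y=\nabla_y\mathcal F(x,y)$; Continuous Alt-HB is the system $\dot x=-\nabla_x\mathcal F(x,y)$, $\dot y=\nabla_y\left(\mathcal F(x,y)-\frac{h}{2(1-\beta)^2}\|\nabla_xf(x,y)\|^2\right)$. Then Continuous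 Sim-HB (resp. Continuous Alt-HB) is locally $\mathcal O(h^3)$-close to Sim-HB (resp. Alt-HB) on $[0,T]$ after $4\log h/\log|\beta|$ steps. That is, for every $K$ there are constants $C$ and $h_0>0$, depending only on $f,\beta,T,K$, such that for all $0<h<h_0$: 1. for every $t_0\in[0,T]$ and every $(a,b)\in\mathbb R^p\times\mathbb R^q$ the continuous system has a solution on $[0,T]$ with $(x(t_0),y(t_0))=(a,b)$; 2. for every discrete trajectory with $\|x_0-x_{-1}\|\le K$ and $\|y_0-y_{-1}\|\le K$, every integer $n\ge 0$ with $n\ge 4\log h/\log|\beta|$ and $(n+1)h\le T$, and every solution $(x(t),y(t))$ of the continuous system on $[nh,(n+1)h]$ with $(x(nh),y(nh))=(x_n,y_n)$, $$\|x((n+1)h)-x_{n+1}\|\le C h^3\quad\text{and}\quad \|y((n+1)h)-y_{n+1}\|\le C h^3 .$$ (For $\beta=0$ the quotient $4\log h/\log|\beta|$ is read as $0$.) -/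

import Mathlib

noncomputable section

namespace HeavyBall

variable {E F : Type*}
  [NormedAddCommGroup E] [InnerProductSpace ℝ E] [CompleteSpace E]
  [NormedAddCommGroup F] [InnerProductSpace ℝ F] [CompleteSpace F]

/-- The partial gradient `∇ₓ f (x, y)`. -/
def gradX (f : E → F → ℝ) (x : E) (y : F) : E := gradient (fun u => f u y) x

/-- The partial gradient `∇_y f (x, y)`. -/
def gradY (f : E → F → ℝ) (x : E) (y : F) : F := gradient (fun v => f x v) y

/-- Simultaneous heavy ball with step size `h` and momentum `β`. The starting data are the points
with indices `-1` and `0`; values at indices below `-1` play no role. -/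
def IsSimHB (f : E → F → ℝ) (β h : ℝ) (x : ℤ → E) (y : ℤ → F) : Prop :=
  ∀ n : ℕ,
    x (n + 1) = x n - h • gradX f (x n) (y n) + β • (x n - x (n - 1)) ∧
    y (n + 1) = y n + h • gradY f (x n) (y n) + β • (y n - y (n - 1))

/-- Alternating heavy ball: the second player already sees `x (n + 1)`. -/
def IsAltHB (f : E → F → ℝ) (β h : ℝ) (x : ℤ → E) (y : ℤ → F) : Prop :=
  ∀ n : ℕ,
    x (n + 1) = x n - h • gradX f (x n) (y n) + β • (x n - x (n - 1)) ∧
    y (n + 1) = y n + h • gradY f (x (n + 1)) (y n) + β • (y n - y (n - 1))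

/-- The modified loss function. -/
def modifiedLoss (f : E → F → ℝ) (β h : ℝ) (x : E) (y : F) : ℝ :=
  1 / (1 - β) * f x y
    + h * (1 + β) / (4 * (1 - β) ^ 3) * (‖gradX f x y‖ ^ 2 - ‖gradY f x y‖ ^ 2)

/-- `(x, y)` solves the continuous-time model of simultaneous heavy ball on the time set `s`. -/
def IsContinuousSimHB (f : E → F → ℝ) (β h : ℝ) (x : ℝ → E) (y : ℝ → F) (s : Set ℝ) : Prop :=
  ∀ t ∈ s,
    HasDerivWithinAt x (-gradX (modifiedLoss f β h) (x t) (y t)) s t ∧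
    HasDerivWithinAt y (gradY (modifiedLoss f β h) (x t) (y t)) s t

/-- `(x, y)` solves the continuous-time model of alternating heavy ball on the time set `s`. -/
def IsContinuousAltHB (f : E → F → ℝ) (β h : ℝ) (x : ℝ → E) (y : ℝ → F) (s : Set ℝ) : Prop :=
  ∀ t ∈ s,
    HasDerivWithinAt x (-gradX (modifiedLoss f β h) (x t) (y t)) s t ∧
    HasDerivWithinAt y
      (gradY (fun u v => modifiedLoss f β h u v - h / (2 * (1 - β) ^ 2) * ‖gradX f u v‖ ^ 2)
        (x t) (y t)) s t

/-- The flow (with parameter `h`) is locally `O(h³)`-close to the discrete trajectories (with step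
size `h`) on `[0, T]` after `4 log h / log |β|` steps. Through every point at every time there is a
solution of the flow on `[0, T]`; and, with `t_n = n h`, a solution that agrees with a discrete
trajectory at time `t_n` is within `C h³` of it at time `t_{n+1}`, for all `n` past the burn-in and
`t_{n+1} ≤ T`. The constant `C` is uniform in `h`, `n`, the solution and the discrete trajectory, as
long as the initial displacement of the latter is at most `K`.
For `β = 0` the number of burn-in steps is `0`, in agreement with `Real.log 0 = 0`, `a / 0 = 0`. -/
def LocallyCubicClose
    (flow : (h : ℝ) → (ℝ → E) → (ℝ → F) → Set ℝ → Prop)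
    (discrete : (h : ℝ) → (ℤ → E) → (ℤ → F) → Prop) (β T : ℝ) : Prop :=
  ∀ K : ℝ, ∃ C h₀ : ℝ, 0 < h₀ ∧ ∀ h : ℝ, 0 < h → h < h₀ →
    (∀ t₀ ∈ Set.Icc 0 T, ∀ (a : E) (b : F), ∃ (x : ℝ → E) (y : ℝ → F),
      flow h x y (Set.Icc 0 T) ∧ x t₀ = a ∧ y t₀ = b) ∧
    ∀ (X : ℤ → E) (Y : ℤ → F), discrete h X Y →
      ‖X 0 - X (-1)‖ ≤ K → ‖Y 0 - Y (-1)‖ ≤ K →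
      ∀ n : ℕ, 4 * Real.log h / Real.log |β| ≤ n → (n + 1) * h ≤ T →
        ∀ (x : ℝ → E) (y : ℝ → F), flow h x y (Set.Icc (n * h) ((n + 1) * h)) →
          x (n * h) = X n → y (n * h) = Y n →
          ‖x ((n + 1) * h) - X (n + 1)‖ ≤ C * h ^ 3 ∧
          ‖y ((n + 1) * h) - Y (n + 1)‖ ≤ C * h ^ 3

end HeavyBall

end

namespace HeavyBall

/-! Put `z = (x, y)` and `v = (-∇ₓf, ∇_y f)`. Both schemes become one recursion for the
displacement, `d (n+1) = β d n + h (v (z n) + Q (v (z n + P d (n+1)) - v (z n)))`: simultaneous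
updates have `P = Q = 0`, alternating ones have `P`, `Q` the projections onto the two factors. Since
`|β| < 1`, the memory of the initial data decays geometrically and `d n` settles on an expansion in
`h` whose coefficients are fixed points of the recursion. With `a = (1 - β)⁻¹` and base point `z
(n-1)`, it is `h a v + h² (-β a³ v' v + a² Q v' P v)`, up to `O(h³ + |β|^n)`
(`norm_displacement_sub_sub_le`).

Over time `h`, the flow of `a v + h (b v' v + a² Q v' P v)` moves by `h a v + h² ((b + a²/2) v' v +
a² Q v' P v) + O(h³)` (`norm_flow_sub_le`). The two agree for `b = -(1 + β) a³ / 2`, and the burn-in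
makes `|β|^(n+1)` at most `h³`.

It remains to see that this field is the stated system. By symmetry of the second derivative, `v' v`
comes from the differential of `‖∇ₓf‖² - ‖∇_y f‖²`, and `Q v' P v` from that of `‖∇ₓf‖²`
(`modifiedLoss_grad_eq`, `modifiedLoss_grad_alt_eq`). -/

/-- Solution of a scalar affine recursive inequality with geometric forcing. -/
theorem le_of_affine_recursion {u : ℕ → ℝ} {ρ A B : ℝ} (hρ0 : 0 ≤ ρ) (hρ1 : ρ < 1) (hA : 0 ≤ A)
    (h : ∀ n, u (n + 1) ≤ ρ * u n + A + B * ρ ^ (n + 1)) (n : ℕ) :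
    u n ≤ A / (1 - ρ) + (u 0 + n * B) * ρ ^ n := by
  have h1 : 0 < 1 - ρ := sub_pos.2 hρ1
  induction n with
  | zero => simpa using div_nonneg hA h1.le
  | succ n ih =>
    have h2 := mul_le_mul_of_nonneg_left ih hρ0
    have h3 : A / (1 - ρ) = ρ * (A / (1 - ρ)) + A := by field_simp; ring
    refine (h n).trans ?_
    push_cast
    rw [pow_succ] at *
    linear_combination h2 - h3

/-! ### Heavy ball and its modified flow for an abstract field. -/

section Field

variable {V : Type*} [NormedAddCommGroup V] [NormedSpace ℝ V]

/-- A vector field `v` with derivative field `v'`, both bounded and Lipschitz with constant `B`,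
and with a quadratic Taylor remainder. -/
structure TameField (v : V → V) (v' : V → V →L[ℝ] V) (B : ℝ) : Prop where
  nonneg : 0 ≤ B
  bound : ∀ z, ‖v z‖ ≤ B
  bound' : ∀ z, ‖v' z‖ ≤ B
  lip : ∀ z w, ‖v z - v w‖ ≤ B * ‖z - w‖
  lip' : ∀ z w, ‖v' z - v' w‖ ≤ B * ‖z - w‖
  taylor : ∀ z d, ‖v (z + d) - v z - v' z d‖ ≤ B * ‖d‖ ^ 2

/-- A heavy ball trajectory for the field `v`. The map `Q` selects the components that are updated
with the new value of the components selected by `P`; `d n` is the displacement from step `n - 1`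
to step `n`. -/
structure IsTrajectory (v : V → V) (P Q : V →L[ℝ] V) (β h : ℝ) (z d : ℕ → V) : Prop where
  step : ∀ n, z (n + 1) = z n + d (n + 1)
  momentum : ∀ n, d (n + 1) = β • d n + h • (v (z n) + Q (v (z n + P (d (n + 1))) - v (z n)))

/-- The second order correction `v' (v) * b + Q (v' (P v)) * c`. -/
def correction (v : V → V) (v' : V → V →L[ℝ] V) (P Q : V →L[ℝ] V) (b c : ℝ) (z : V) : V :=
  b • v' z (v z) + c • Q (v' z (P (v z)))

variable {v : V → V} {v' : V → V →L[ℝ] V} {B : ℝ} {P Q : V →L[ℝ] V}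

theorem TameField.norm_apply_sub_le (hv : TameField v v' B) (hP : ∀ z, ‖P z‖ ≤ ‖z‖) (z w : V) :
    ‖v' z (P (v z)) - v' w (P (v w))‖ ≤ 2 * B ^ 2 * ‖z - w‖ := by
  have e : v' z (P (v z)) - v' w (P (v w)) = (v' z - v' w) (P (v z)) + v' w (P (v z - v w)) := by
    simp
  have h1 : ‖(v' z - v' w) (P (v z))‖ ≤ (B * ‖z - w‖) * B :=
    ((v' z - v' w).le_opNorm _).trans (mul_le_mul (hv.lip' z w) ((hP _).trans (hv.bound z))
      (norm_nonneg _) (mul_nonneg hv.nonneg (norm_nonneg _)))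
  have h2 : ‖v' w (P (v z - v w))‖ ≤ B * (B * ‖z - w‖) :=
    ((v' w).le_opNorm _).trans (mul_le_mul (hv.bound' w) ((hP _).trans (hv.lip z w))
      (norm_nonneg _) hv.nonneg)
  rw [e]
  refine (norm_add_le _ _).trans ?_
  linear_combination h1 + h2

theorem TameField.norm_apply_le (hv : TameField v v' B) (hP : ∀ z, ‖P z‖ ≤ ‖z‖) (z : V) :
    ‖v' z (P (v z))‖ ≤ B ^ 2 := by
  rw [sq]
  exact ((v' z).le_opNorm _).trans (mul_le_mul (hv.bound' z) ((hP _).trans (hv.bound z))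
      (norm_nonneg _) hv.nonneg)

theorem TameField.norm_correction_le (hv : TameField v v' B) (hP : ∀ z, ‖P z‖ ≤ ‖z‖)
    (hQ : ∀ z, ‖Q z‖ ≤ ‖z‖) (b c : ℝ) (z : V) :
    ‖correction v v' P Q b c z‖ ≤ (|b| + |c|) * B ^ 2 := by
  have h1 := mul_le_mul_of_nonneg_left
    (hv.norm_apply_le (P := ContinuousLinearMap.id ℝ V) (fun _ => le_rfl) z) (abs_nonneg b)
  have h2 := mul_le_mul_of_nonneg_left ((hQ _).trans (hv.norm_apply_le hP z)) (abs_nonneg c)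
  refine (norm_add_le _ _).trans ?_
  rw [norm_smul, norm_smul, Real.norm_eq_abs, Real.norm_eq_abs]
  simp only [ContinuousLinearMap.id_apply] at h1
  linear_combination h1 + h2

theorem TameField.norm_correction_sub_le (hv : TameField v v' B) (hP : ∀ z, ‖P z‖ ≤ ‖z‖)
    (hQ : ∀ z, ‖Q z‖ ≤ ‖z‖) (b c : ℝ) (z w : V) :
    ‖correction v v' P Q b c z - correction v v' P Q b c w‖
      ≤ 2 * (|b| + |c|) * B ^ 2 * ‖z - w‖ := by
  have h1 := mul_le_mul_of_nonneg_left
    (hv.norm_apply_sub_le (P := ContinuousLinearMap.id ℝ V) (fun _ => le_rfl) z w) (abs_nonneg b)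
  have h2 := mul_le_mul_of_nonneg_left ((hQ _).trans (hv.norm_apply_sub_le hP z w)) (abs_nonneg c)
  have e : correction v v' P Q b c z - correction v v' P Q b c w
      = b • (v' z (v z) - v' w (v w)) + c • Q (v' z (P (v z)) - v' w (P (v w))) := by
    simp only [correction, map_sub]; module
  rw [e]
  refine (norm_add_le _ _).trans ?_
  rw [norm_smul, norm_smul, Real.norm_eq_abs, Real.norm_eq_abs]
  simp only [ContinuousLinearMap.id_apply] at h1
  linear_combination h1 + h2

/-! ### Expansion of the displacement in powers of `h`. -/

theorem TameField.norm_displacement_le (hv : TameField v v' B) (hQ : ∀ z, ‖Q z‖ ≤ ‖z‖)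
    {β : ℝ} (hβ : |β| < 1) {K : ℝ} (hK : 0 ≤ K) :
    ∃ D, 0 ≤ D ∧ ∀ h : ℝ, 0 < h → ∀ z d : ℕ → V, IsTrajectory v P Q β h z d → ‖d 0‖ ≤ K →
      ∀ n, ‖d n‖ ≤ D * (h + |β| ^ n) := by
  have h1 : 0 < 1 - |β| := sub_pos.2 hβ
  have hB := hv.nonneg
  refine ⟨3 * B / (1 - |β|) + K, by positivity, fun h hh z d ht hd n => ?_⟩
  -- There is no geometric forcing at this order; the zero term only fits the shape of
  -- `le_of_affine_recursion`.
  have hrec : ∀ n, ‖d (n + 1)‖ ≤ |β| * ‖d n‖ + h * (3 * B) + 0 * |β| ^ (n + 1) := by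
    intro n
    have h2 : ‖v (z n) + Q (v (z n + P (d (n + 1))) - v (z n))‖ ≤ 3 * B := by
      refine (norm_add_le _ _).trans ?_
      have h3 := (hQ (v (z n + P (d (n + 1))) - v (z n))).trans (norm_sub_le _ _)
      linarith [hv.bound (z n), hv.bound (z n + P (d (n + 1)))]
    conv_lhs => rw [ht.momentum n]
    refine (norm_add_le _ _).trans ?_
    rw [norm_smul, norm_smul, Real.norm_eq_abs, Real.norm_eq_abs, abs_of_pos hh]
    have := mul_le_mul_of_nonneg_left h2 hh.le
    linarith
  have h4 := le_of_affine_recursion (u := fun n => ‖d n‖) (abs_nonneg β) hβ (by positivity) hrec n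
  have h5 : 0 ≤ |β| ^ n := by positivity
  have h6 := mul_le_mul_of_nonneg_right hd h5
  have h7 : 0 ≤ 3 * B / (1 - |β|) * |β| ^ n := by positivity
  have h8 : 0 ≤ K * h := by positivity
  refine h4.trans ?_
  linear_combination h6 + h7 + h8

/-- The leading coefficient `a = (1 - β)⁻¹` solves `a = β a + 1`. What is left obeys the same
contraction, forced by increments of `v` along displacements of size `O(h + |β|^n)`. -/
theorem TameField.norm_displacement_sub_le (hv : TameField v v' B) (hP : ∀ z, ‖P z‖ ≤ ‖z‖)
    (hQ : ∀ z, ‖Q z‖ ≤ ‖z‖) {β : ℝ} (hβ : |β| < 1) {K T : ℝ} (hK : 0 ≤ K) (hT : 0 ≤ T) :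
    ∃ S, 0 ≤ S ∧ ∀ h : ℝ, 0 < h → h < 1 → ∀ z d : ℕ → V, IsTrajectory v P Q β h z d →
      ‖d 0‖ ≤ K → ∀ n : ℕ, n * h ≤ T →
        ‖d n - (h * (1 - β)⁻¹) • v (z n - d n)‖ ≤ S * (h ^ 2 + |β| ^ n) := by
  obtain ⟨D, hD, hd⟩ := hv.norm_displacement_le (P := P) hQ hβ hK
  have h1 : 0 < 1 - |β| := sub_pos.2 hβ
  have hB := hv.nonneg
  have h1' : 0 < 1 - β := by linarith [le_abs_self β]
  obtain ⟨a, ha⟩ : ∃ a, a = (1 - β)⁻¹ := ⟨_, rfl⟩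
  have ha0 : 0 < a := by rw [ha]; positivity
  have hab : a * (1 - β) = 1 := by rw [ha]; exact inv_mul_cancel₀ h1'.ne'
  rw [← ha]
  obtain ⟨G, hG⟩ : ∃ G, G = (a + 1) * B * D := ⟨_, rfl⟩
  have hG0 : 0 ≤ G := by rw [hG]; positivity
  refine ⟨G / (1 - |β|) + (K + a * B) + T * G, by positivity, fun h hh hh1 z d ht hd0 n hn => ?_⟩
  obtain ⟨s, hs⟩ : ∃ s : ℕ → V, ∀ n, s n = d n - (h * a) • v (z n - d n) := ⟨_, fun _ => rfl⟩
  have hrec : ∀ n, ‖s (n + 1)‖ ≤ |β| * ‖s n‖ + G * h ^ 2 + G * h * |β| ^ (n + 1) := by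
    intro n
    have e : s (n + 1) = β • s n + (β * h * a) • (v (z n - d n) - v (z n))
        + h • Q (v (z n + P (d (n + 1))) - v (z n)) := by
      -- Thus `z n - d n` is the previous iterate, and for `n = 0` the point with index `-1`.
      have e1 : z (n + 1) - d (n + 1) = z n := by rw [ht.step n]; abel
      rw [hs, hs, e1]
      obtain ⟨q, hq⟩ : ∃ q, q = Q (v (z n + P (d (n + 1))) - v (z n)) := ⟨_, rfl⟩
      have e2 := ht.momentum n
      rw [← hq] at e2 ⊢
      rw [e2]
      match_scalars <;> first | ring1 | linear_combination (-h) * hab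
    have b1 : ‖v (z n - d n) - v (z n)‖ ≤ B * (D * (h + |β| ^ n)) := by
      refine (hv.lip _ _).trans (mul_le_mul_of_nonneg_left ?_ hB)
      simpa using hd h hh z d ht hd0 n
    have b2 : ‖Q (v (z n + P (d (n + 1))) - v (z n))‖ ≤ B * (D * (h + |β| ^ (n + 1))) := by
      refine (hQ _).trans ((hv.lip _ _).trans (mul_le_mul_of_nonneg_left ?_ hB))
      simpa using (hP _).trans (hd h hh z d ht hd0 (n + 1))
    rw [e]
    refine (norm_add₃_le).trans ?_
    rw [norm_smul, norm_smul, norm_smul, Real.norm_eq_abs, Real.norm_eq_abs, Real.norm_eq_abs,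
      abs_mul, abs_mul, abs_of_pos hh, abs_of_pos ha0]
    have b3 := mul_le_mul_of_nonneg_left b1 (by positivity : 0 ≤ |β| * h * a)
    have b4 := mul_le_mul_of_nonneg_left b2 hh.le
    have b5 : |β| * (a * B * D * h ^ 2) ≤ 1 * (a * B * D * h ^ 2) :=
      mul_le_mul_of_nonneg_right hβ.le (by positivity)
    rw [hG]
    linear_combination b3 + b4 + b5
  have h4 := le_of_affine_recursion (u := fun n => ‖s n‖) (abs_nonneg β) hβ (by positivity) hrec n
  have h0 : ‖s 0‖ ≤ K + a * B := by
    rw [hs]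
    refine (norm_sub_le _ _).trans (add_le_add hd0 ?_)
    rw [norm_smul, Real.norm_eq_abs, abs_of_pos (by positivity)]
    exact mul_le_mul (mul_le_of_le_one_left ha0.le hh1.le) (hv.bound _) (norm_nonneg _) ha0.le
  have h5 : 0 ≤ |β| ^ n := by positivity
  have h6 := mul_le_mul_of_nonneg_right h0 h5
  -- Forcing at the contraction rate is resonant and costs a factor `n`; the finite horizon `n h ≤
  -- T` absorbs it.
  have h7 := mul_le_mul_of_nonneg_right (mul_le_mul_of_nonneg_right hn hG0) h5
  have h8 : 0 ≤ G / (1 - |β|) * |β| ^ n := by positivity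
  have h9 : 0 ≤ ((K + a * B) + T * G) * h ^ 2 := by positivity
  rw [← hs]
  refine h4.trans ?_
  linear_combination h6 + h7 + h8 + h9

/-- The bootstrap repeated one order higher: the bound `D` on `d` controls Taylor remainders, and
the bound `S` on the first-order error allows `d` to be replaced by `h a v` inside `v'`. -/
theorem TameField.norm_displacement_sub_sub_le (hv : TameField v v' B) (hP : ∀ z, ‖P z‖ ≤ ‖z‖)
    (hQ : ∀ z, ‖Q z‖ ≤ ‖z‖) {β : ℝ} (hβ : |β| < 1) {K T : ℝ} (hK : 0 ≤ K) (hT : 0 ≤ T) :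
    ∃ R, 0 ≤ R ∧ ∀ h : ℝ, 0 < h → h < 1 → ∀ z d : ℕ → V, IsTrajectory v P Q β h z d →
      ‖d 0‖ ≤ K → ∀ n : ℕ, n * h ≤ T →
        ‖d n - (h * (1 - β)⁻¹) • v (z n - d n) - h ^ 2 • correction v v' P Q
          (-β * (1 - β)⁻¹ ^ 3) ((1 - β)⁻¹ ^ 2) (z n - d n)‖ ≤ R * (h ^ 3 + |β| ^ n) := by
  obtain ⟨D, hD, hd⟩ := hv.norm_displacement_le (P := P) hQ hβ hK
  obtain ⟨S, hS, hs⟩ := hv.norm_displacement_sub_le hP hQ hβ hK hT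
  have h1 : 0 < 1 - |β| := sub_pos.2 hβ
  have hB := hv.nonneg
  have h1' : 0 < 1 - β := by linarith [le_abs_self β]
  obtain ⟨a, ha⟩ : ∃ a, a = (1 - β)⁻¹ := ⟨_, rfl⟩
  have ha0 : 0 < a := by rw [ha]; positivity
  have hab : a * (1 - β) = 1 := by rw [ha]; exact inv_mul_cancel₀ h1'.ne'
  rw [← ha] at hs ⊢
  obtain ⟨p, hp⟩ : ∃ p, p = correction v v' P Q (-β * a ^ 3) (a ^ 2) := ⟨_, rfl⟩
  obtain ⟨L, hL0, hL, hLb⟩ : ∃ L, 0 ≤ L ∧ (∀ z w, ‖p z - p w‖ ≤ L * ‖z - w‖) ∧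
      ∀ z, ‖p z‖ ≤ L := by
    refine ⟨2 * (|-β * a ^ 3| + |a ^ 2|) * B ^ 2, by positivity, ?_, fun z => ?_⟩
    · rw [hp]; exact hv.norm_correction_sub_le hP hQ _ _
    · rw [hp]
      refine (hv.norm_correction_le hP hQ _ _ z).trans ?_
      have : 0 ≤ (|-β * a ^ 3| + |a ^ 2|) * B ^ 2 := by positivity
      linarith
  rw [← hp]
  obtain ⟨G, hG⟩ : ∃ G, G = 2 * (a + 1) * B * D ^ 2 + L * D + (a + 1) * B * S + a ^ 2 * B ^ 2 * D :=
    ⟨_, rfl⟩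
  have hG0 : 0 ≤ G := by rw [hG]; positivity
  refine ⟨G / (1 - |β|) + (K + a * B + L) + T * G, by positivity,
    fun h hh hh1 z d ht hd0 n hn => ?_⟩
  obtain ⟨s, hsd⟩ : ∃ s : ℕ → V, ∀ n, s n = d n - (h * a) • v (z n - d n) := ⟨_, fun _ => rfl⟩
  obtain ⟨r, hr⟩ : ∃ r : ℕ → V, ∀ n, r n = d n - (h * a) • v (z n - d n) - h ^ 2 • p (z n - d n) :=
    ⟨_, fun _ => rfl⟩
  have hβn : ∀ n, 0 ≤ |β| ^ n := fun n => by positivity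
  have hβn1 : ∀ n, |β| ^ n ≤ 1 := fun n => pow_le_one₀ (abs_nonneg β) hβ.le
  -- As `|β|^n ≤ 1`, squaring keeps the geometric part of the form `|β|^n`.
  have hsq : ∀ n, ‖d n‖ ^ 2 ≤ 2 * D ^ 2 * (h ^ 2 + |β| ^ n) := fun n => by
    have b1 := pow_le_pow_left₀ (norm_nonneg _) (hd h hh z d ht hd0 n) 2
    have b2 : (h + |β| ^ n) ^ 2 ≤ 2 * (h ^ 2 + |β| ^ n) := by
      nlinarith [sq_nonneg (h - |β| ^ n), mul_le_mul_of_nonneg_left (hβn1 n) (hβn n)]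
    have b3 := mul_le_mul_of_nonneg_left b2 (sq_nonneg D)
    linear_combination b1 + b3
  have hrec : ∀ n : ℕ, ((n + 1 : ℕ) : ℝ) * h ≤ T →
      ‖r (n + 1)‖ ≤ |β| * ‖r n‖ + G * h ^ 3 + G * h * |β| ^ (n + 1) := by
    intro n hn1
    have hn0 : (n : ℝ) * h ≤ T := by push_cast at hn1; linarith
    have e1 : z (n + 1) - d (n + 1) = z n := by rw [ht.step n]; abel
    -- Taylor expansion at `z n`. The terms of order `h` and `h²` cancel because `a = β a + 1`, `b =
    -- β b - β a²` and `c = β c + a` for `b = -β a³`, `c = a²`.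
    have e : r (n + 1) = β • r n + (β * h * a) • (v (z n + -d n) - v (z n) - v' (z n) (-d n))
        + (β * h ^ 2) • (p (z n - d n) - p (z n))
        + h • Q (v (z n + P (d (n + 1))) - v (z n) - v' (z n) (P (d (n + 1))))
        - (β * h * a) • v' (z n) (s n)
        - (β * h ^ 2 * a ^ 2) • v' (z n) (v (z n - d n) - v (z n))
        + h • Q (v' (z n) (P (s (n + 1)))) := by
      rw [hr, hr, hsd, hsd, e1, ← sub_eq_add_neg]
      have e3 : p (z n) = (-β * a ^ 3) • v' (z n) (v (z n))
        + (a ^ 2) • Q (v' (z n) (P (v (z n)))) := by rw [hp]; rfl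
      obtain ⟨q, hq⟩ : ∃ q, q = v (z n + P (d (n + 1))) := ⟨_, rfl⟩
      have e2 := ht.momentum n
      rw [← hq] at e2 ⊢
      simp only [map_sub, map_smul, map_neg] at e2 ⊢
      rw [e3]
      generalize Q (v' (z n) (P (d (n + 1)))) = c1
      rw [e2]
      match_scalars
      all_goals first
        | ring1
        | linear_combination (-h) * hab
        | linear_combination h ^ 2 * β * a ^ 2 * hab
        | linear_combination (-h ^ 2 * a) * hab
    have b1 : ‖v (z n + -d n) - v (z n) - v' (z n) (-d n)‖ ≤ B * (2 * D ^ 2 * (h ^ 2 + |β| ^ n)) := by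
      refine (hv.taylor _ _).trans (mul_le_mul_of_nonneg_left ?_ hB)
      rw [norm_neg]; exact hsq n
    have b2 : ‖p (z n - d n) - p (z n)‖ ≤ L * (D * (h + |β| ^ n)) := by
      refine (hL _ _).trans (mul_le_mul_of_nonneg_left ?_ hL0)
      simpa using hd h hh z d ht hd0 n
    have b3 : ‖Q (v (z n + P (d (n + 1))) - v (z n) - v' (z n) (P (d (n + 1))))‖
        ≤ B * (2 * D ^ 2 * (h ^ 2 + |β| ^ (n + 1))) := by
      refine (hQ _).trans ((hv.taylor _ _).trans (mul_le_mul_of_nonneg_left ?_ hB))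
      exact (pow_le_pow_left₀ (norm_nonneg _) (hP _) 2).trans (hsq (n + 1))
    have b4 : ‖v' (z n) (s n)‖ ≤ B * (S * (h ^ 2 + |β| ^ n)) := by
      refine ((v' (z n)).le_opNorm _).trans (mul_le_mul (hv.bound' _) ?_ (norm_nonneg _) hB)
      rw [hsd]; exact hs h hh hh1 z d ht hd0 n hn0
    have b5 : ‖v' (z n) (v (z n - d n) - v (z n))‖ ≤ B * (B * (D * (h + |β| ^ n))) := by
      refine ((v' (z n)).le_opNorm _).trans (mul_le_mul (hv.bound' _) ?_ (norm_nonneg _) hB)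
      refine (hv.lip _ _).trans (mul_le_mul_of_nonneg_left ?_ hB)
      simpa using hd h hh z d ht hd0 n
    have b6 : ‖Q (v' (z n) (P (s (n + 1))))‖ ≤ B * (S * (h ^ 2 + |β| ^ (n + 1))) := by
      refine (hQ _).trans (((v' (z n)).le_opNorm _).trans
        (mul_le_mul (hv.bound' _) ((hP _).trans ?_) (norm_nonneg _) hB))
      rw [hsd]; exact hs h hh hh1 z d ht hd0 (n + 1) hn1
    have hβ0 := abs_nonneg β
    have c : ∀ {k : ℝ} {x : V} {m : ℝ}, 0 ≤ k → ‖x‖ ≤ m → ‖(β * k) • x‖ ≤ |β| * k * m := by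
      intro k x m hk hx
      rw [norm_smul, Real.norm_eq_abs, abs_mul, abs_of_nonneg hk]
      exact mul_le_mul_of_nonneg_left hx (by positivity)
    have c' : ∀ {x : V} {m : ℝ}, ‖x‖ ≤ m → ‖h • x‖ ≤ h * m := by
      intro x m hx
      rw [norm_smul, Real.norm_eq_abs, abs_of_pos hh]
      exact mul_le_mul_of_nonneg_left hx hh.le
    have d0 : ‖β • r n‖ = |β| * ‖r n‖ := by rw [norm_smul, Real.norm_eq_abs]
    have d1 := c (by positivity : 0 ≤ h * a) b1
    have d2 := c (by positivity : 0 ≤ h ^ 2) b2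
    have d3 := c' b3
    have d4 := c (by positivity : 0 ≤ h * a) b4
    have d5 := c (by positivity : 0 ≤ h ^ 2 * a ^ 2) b5
    have d6 := c' b6
    simp only [← mul_assoc] at d1 d2 d4 d5
    have tri : ∀ x₀ x₁ x₂ x₃ x₄ x₅ x₆ : V, ‖x₀ + x₁ + x₂ + x₃ - x₄ - x₅ + x₆‖
        ≤ ‖x₀‖ + ‖x₁‖ + ‖x₂‖ + ‖x₃‖ + ‖x₄‖ + ‖x₅‖ + ‖x₆‖ := by
      intro x₀ x₁ x₂ x₃ x₄ x₅ x₆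
      linarith [norm_add_le (x₀ + x₁ + x₂ + x₃ - x₄ - x₅) x₆, norm_sub_le (x₀ + x₁ + x₂ + x₃ - x₄) x₅,
        norm_sub_le (x₀ + x₁ + x₂ + x₃) x₄, norm_add_le (x₀ + x₁ + x₂) x₃, norm_add_le (x₀ + x₁) x₂,
        norm_add_le x₀ x₁]
    rw [e]
    refine (tri _ _ _ _ _ _ _).trans ?_
    -- In the terms carrying `|β|`, this factor raises `|β|^n` to `|β|^(n+1)` and is dropped from
    -- the `h³` parts, collected in `M`.
    obtain ⟨M, hM⟩ : ∃ M, M = 2 * a * B * D ^ 2 + L * D + a * B * S + a ^ 2 * B ^ 2 * D := ⟨_, rfl⟩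
    have hM0 : 0 ≤ M := by rw [hM]; positivity
    have k1 : |β| * (M * h ^ 3) ≤ 1 * (M * h ^ 3) :=
      mul_le_mul_of_nonneg_right hβ.le (by positivity)
    have k2 : h * ((L * D + a ^ 2 * B ^ 2 * D) * h * |β| ^ (n + 1))
        ≤ 1 * ((L * D + a ^ 2 * B ^ 2 * D) * h * |β| ^ (n + 1)) :=
      mul_le_mul_of_nonneg_right hh1.le (by positivity)
    rw [hM] at k1
    rw [hG, d0]
    linear_combination d1 + d2 + d3 + d4 + d5 + d6 + k1 + k2
  -- The induction of `le_of_affine_recursion` is redone because `hrec` holds only up to time `T`.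
  have h4 : ‖r n‖ ≤ G * h ^ 3 / (1 - |β|) + (‖r 0‖ + n * (G * h)) * |β| ^ n := by
    clear hsq
    induction n with
    | zero =>
      have : 0 ≤ G * h ^ 3 / (1 - |β|) := by positivity
      simpa
    | succ n ih =>
      have ih := mul_le_mul_of_nonneg_left (ih (by push_cast at hn; linarith)) (abs_nonneg β)
      have h3 : G * h ^ 3 / (1 - |β|) = |β| * (G * h ^ 3 / (1 - |β|)) + G * h ^ 3 := by
        field_simp; ring
      refine (hrec n hn).trans ?_
      push_cast
      linear_combination ih - h3
  have h0 : ‖r 0‖ ≤ K + a * B + L := by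
    rw [hr]
    refine (norm_sub_le _ _).trans (add_le_add ((norm_sub_le _ _).trans (add_le_add hd0 ?_)) ?_)
    · rw [norm_smul, Real.norm_eq_abs, abs_of_pos (by positivity)]
      exact mul_le_mul (mul_le_of_le_one_left ha0.le hh1.le) (hv.bound _) (norm_nonneg _) ha0.le
    · rw [norm_smul, Real.norm_eq_abs, abs_of_pos (by positivity)]
      exact (mul_le_of_le_one_left (norm_nonneg _) (pow_le_one₀ hh.le hh1.le)).trans (hLb _)
  have h5 := hβn n
  have h6 := mul_le_mul_of_nonneg_right h0 h5
  have h7 := mul_le_mul_of_nonneg_right (mul_le_mul_of_nonneg_right hn hG0) h5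
  have h8 : 0 ≤ G / (1 - |β|) * |β| ^ n := by positivity
  have h9 : 0 ≤ ((K + a * B + L) + T * G) * h ^ 3 := by positivity
  rw [← hr]
  refine h4.trans ?_
  linear_combination h6 + h7 + h8 + h9

/-! ### Existence and short-time expansion of the flow. -/

/-- A bounded Lipschitz autonomous field has solutions on every compact interval. -/
theorem exists_solution_of_bounded_of_lipschitz [CompleteSpace V] {W : V → V} {M L : ℝ}
    (hM : ∀ z, ‖W z‖ ≤ M) (hL : ∀ z w, ‖W z - W w‖ ≤ L * ‖z - w‖) {T t₀ : ℝ}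
    (ht₀ : t₀ ∈ Set.Icc 0 T) (z₀ : V) :
    ∃ z : ℝ → V, z t₀ = z₀ ∧ ∀ t ∈ Set.Icc 0 T, HasDerivWithinAt z (W (z t)) (Set.Icc 0 T) t := by
  have hT : 0 ≤ T := ht₀.1.trans ht₀.2
  -- A field bounded by `M` moves a point by at most `M T` on `[0, T]`, so a ball of that radius
  -- suffices, with no smallness of `T`.
  have hpl : IsPicardLindelof (fun _ => W) (⟨t₀, ht₀⟩ : Set.Icc 0 T) z₀
      (M.toNNReal * T.toNNReal) 0 M.toNNReal L.toNNReal :=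
    { lipschitzOnWith := fun t _ => (LipschitzWith.of_dist_le_mul fun z w => by
        rw [dist_eq_norm, dist_eq_norm]
        exact (hL z w).trans (mul_le_mul_of_nonneg_right (Real.le_coe_toNNReal L)
          (norm_nonneg _))).lipschitzOnWith
      continuousOn := fun _ _ => continuousOn_const
      norm_le := fun _ _ z _ => (hM z).trans (Real.le_coe_toNNReal M)
      mul_max_le := by
        push_cast
        rw [sub_zero, sub_zero, Real.coe_toNNReal T hT]
        refine mul_le_mul_of_nonneg_left (max_le ?_ ?_) (NNReal.coe_nonneg _)
        · linarith [ht₀.1]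
        · linarith [ht₀.2] }
  exact hpl.exists_eq_forall_mem_Icc_hasDerivWithinAt₀

/-- Second order expansion of the flow of `a v + h p`, where `p` is a correction field. -/
theorem TameField.norm_flow_sub_le (hv : TameField v v' B) (hP : ∀ z, ‖P z‖ ≤ ‖z‖)
    (hQ : ∀ z, ‖Q z‖ ≤ ‖z‖) (a b c : ℝ) :
    ∃ C, 0 ≤ C ∧ ∀ h : ℝ, 0 < h → h < 1 → ∀ (t₀ : ℝ) (z : ℝ → V),
      (∀ t ∈ Set.Icc t₀ (t₀ + h), HasDerivWithinAt z
        (a • v (z t) + h • correction v v' P Q b c (z t)) (Set.Icc t₀ (t₀ + h)) t) →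
      ‖z (t₀ + h) - z t₀ - (h * a) • v (z t₀)
        - h ^ 2 • correction v v' P Q (b + a ^ 2 / 2) c (z t₀)‖ ≤ C * h ^ 3 := by
  obtain ⟨p, hp⟩ : ∃ p, p = correction v v' P Q b c := ⟨_, rfl⟩
  obtain ⟨L, hL0, hL, hLb⟩ : ∃ L, 0 ≤ L ∧ (∀ z w, ‖p z - p w‖ ≤ L * ‖z - w‖) ∧
      ∀ z, ‖p z‖ ≤ L := by
    refine ⟨2 * (|b| + |c|) * B ^ 2, by positivity, ?_, fun z => ?_⟩
    · rw [hp]; exact hv.norm_correction_sub_le hP hQ _ _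
    · rw [hp]
      refine (hv.norm_correction_le hP hQ _ _ z).trans ?_
      have : 0 ≤ (|b| + |c|) * B ^ 2 := by positivity
      linarith
  rw [← hp]
  have hB := hv.nonneg
  obtain ⟨M, hM⟩ : ∃ M, M = |a| * B + L := ⟨_, rfl⟩
  have hM0 : 0 ≤ M := by rw [hM]; positivity
  obtain ⟨N, hN⟩ : ∃ N, N = |a| * B * M + L := ⟨_, rfl⟩
  have hN0 : 0 ≤ N := by rw [hN]; positivity
  refine ⟨|a| * (B * M ^ 2 + B * N) + L * M, by positivity, fun h hh hh1 t₀ z hz => ?_⟩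
  have hmem : t₀ + h ∈ Set.Icc t₀ (t₀ + h) := ⟨by linarith, le_rfl⟩
  have e : z (t₀ + h) - z t₀ - (h * a) • v (z t₀)
        - h ^ 2 • correction v v' P Q (b + a ^ 2 / 2) c (z t₀)
      = (z (t₀ + h) - h • (a • v (z t₀) + h • p (z t₀)) - (h ^ 2 / 2) • a ^ 2 • v' (z t₀) (v (z t₀)))
        - z t₀ := by
    rw [hp]; simp only [correction]; module
  have norm_a : ∀ {x : V} {m : ℝ}, ‖x‖ ≤ m → ‖a • x‖ ≤ |a| * m := by
    intro x m hx
    rw [norm_smul, Real.norm_eq_abs]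
    exact mul_le_mul_of_nonneg_left hx (abs_nonneg a)
  have norm_h : ∀ {x : V} {m : ℝ}, ‖x‖ ≤ m → ‖h • x‖ ≤ h * m := by
    intro x m hx
    rw [norm_smul, Real.norm_eq_abs, abs_of_pos hh]
    exact mul_le_mul_of_nonneg_left hx hh.le
  have le_h : ∀ {t : ℝ} {k : ℝ}, 0 ≤ k → t ∈ Set.Icc t₀ (t₀ + h) → k * (t - t₀) ≤ k * h :=
    fun hk ht => mul_le_mul_of_nonneg_left (by linarith [ht.2]) hk
  have order0 : ∀ t ∈ Set.Icc t₀ (t₀ + h), ‖z t - z t₀‖ ≤ M * h := fun t ht =>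
    (norm_image_sub_le_of_norm_deriv_le_segment' hz (fun t _ => by
      refine (norm_add_le _ _).trans ?_
      have h1 := norm_a (hv.bound (z t))
      have h2 := norm_h (hLb (z t))
      have h3 := mul_le_of_le_one_left hL0 hh1.le
      rw [hM]; linarith) t ht).trans (le_h hM0 ht)
  have order1 : ∀ t ∈ Set.Icc t₀ (t₀ + h),
      ‖z t - z t₀ - (t - t₀) • a • v (z t₀)‖ ≤ N * h * h := by
    intro t ht
    have h0 : ∀ t ∈ Set.Icc t₀ (t₀ + h), HasDerivWithinAt
        (fun t => z t - (t - t₀) • a • v (z t₀))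
        (a • (v (z t) - v (z t₀)) + h • p (z t)) (Set.Icc t₀ (t₀ + h)) t := by
      intro t ht
      have := (hz t ht).sub
        (((hasDerivWithinAt_id t _).sub_const t₀).smul_const (a • v (z t₀)))
      convert this using 1
      · rfl
      · module
    have h1 := norm_image_sub_le_of_norm_deriv_le_segment' h0 (C := N * h) (fun t ht => by
      refine (norm_add_le _ _).trans ?_
      have h1 := norm_a ((hv.lip (z t) (z t₀)).trans
        (mul_le_mul_of_nonneg_left (order0 t (Set.Ico_subset_Icc_self ht)) hB))
      have h2 := norm_h (hLb (z t))
      rw [hN]; linarith) t ht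
    refine le_trans (le_of_eq ?_) (h1.trans (le_h (by positivity) ht))
    congr 1
    simp only [sub_self, zero_smul, sub_zero]
    abel
  -- The derivative of the second-order remainder is split into a Taylor remainder, `v'` of the
  -- first-order remainder, and `h` times an increment of `p`. Each is `O(h²)`, so integrating over
  -- length `h` gives `h³`.
  have order2 : ∀ t ∈ Set.Icc t₀ (t₀ + h), HasDerivWithinAt
      (fun t => z t - (t - t₀) • (a • v (z t₀) + h • p (z t₀))
        - ((t - t₀) ^ 2 / 2) • a ^ 2 • v' (z t₀) (v (z t₀)))
      (a • ((v (z t₀ + (z t - z t₀)) - v (z t₀) - v' (z t₀) (z t - z t₀))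
        + v' (z t₀) (z t - z t₀ - (t - t₀) • a • v (z t₀))) + h • (p (z t) - p (z t₀)))
      (Set.Icc t₀ (t₀ + h)) t := by
    intro t ht
    have h0 := (hasDerivWithinAt_id t (Set.Icc t₀ (t₀ + h))).sub_const t₀
    have := ((hz t ht).sub (h0.smul_const (a • v (z t₀) + h • p (z t₀)))).sub
      (((h0.pow 2).div_const 2).smul_const (a ^ 2 • v' (z t₀) (v (z t₀))))
    convert this using 1
    · rfl
    · rw [add_sub_cancel]
      simp only [map_sub, map_smul, id, Nat.cast_ofNat, Nat.add_one_sub_one, pow_one]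
      module
  have h1 := norm_image_sub_le_of_norm_deriv_le_segment' order2
    (C := (|a| * (B * M ^ 2 + B * N) + L * M) * h ^ 2) (fun t ht => by
    have ht' := Set.Ico_subset_Icc_self ht
    refine (norm_add_le _ _).trans ?_
    have k1 := (hv.taylor (z t₀) (z t - z t₀)).trans (mul_le_mul_of_nonneg_left
      (pow_le_pow_left₀ (norm_nonneg _) (order0 t ht') 2) hB)
    have k2 := ((v' (z t₀)).le_opNorm _).trans
      (mul_le_mul (hv.bound' _) (order1 t ht') (norm_nonneg _) hB)
    have k3 := norm_a ((norm_add_le _ _).trans (add_le_add k1 k2))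
    have k4 := norm_h ((hL (z t) (z t₀)).trans (mul_le_mul_of_nonneg_left (order0 t ht') hL0))
    linear_combination k3 + k4) (t₀ + h) hmem
  rw [e]
  simp only [add_sub_cancel_left, sub_self, zero_smul, sub_zero, ne_eq, OfNat.ofNat_ne_zero,
    not_false_eq_true, zero_pow, zero_div] at h1
  refine h1.trans (le_of_eq (by ring))

/-! ### Matching the flow with the discrete step. -/

/-- The modified vector field whose flow matches heavy ball up to third order. -/
noncomputable def modifiedField (v : V → V) (v' : V → V →L[ℝ] V) (P Q : V →L[ℝ] V) (β h : ℝ) (z : V) : V :=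
  (1 - β)⁻¹ • v z
    + h • correction v v' P Q (-(1 + β) / 2 * (1 - β)⁻¹ ^ 3) ((1 - β)⁻¹ ^ 2) z

/-- The exponent `n + 1` matters for `β = 0`, where the burn-in is empty and `0 ^ 0 = 1` would break
the bound at `n = 0`. -/
theorem abs_pow_succ_le_of_burn_in {β h : ℝ} (hβ : |β| < 1) (hh : 0 < h) (hh1 : h < 1) {n : ℕ}
    (hn : 4 * Real.log h / Real.log |β| ≤ n) : |β| ^ (n + 1) ≤ h ^ 3 := by
  rcases eq_or_ne β 0 with rfl | hβ0
  · simp only [abs_zero, ne_eq, Nat.add_eq_zero_iff, one_ne_zero, and_false, not_false_eq_true,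
      zero_pow]
    positivity
  · have hpos : 0 < |β| := abs_pos.2 hβ0
    have hlog : Real.log |β| < 0 := Real.log_neg hpos hβ
    have h1 : n * Real.log |β| ≤ 4 * Real.log h := (div_le_iff_of_neg hlog).1 hn
    have h2 : |β| ^ n ≤ h ^ 4 := by
      rw [← Real.log_le_log_iff (by positivity) (by positivity), Real.log_pow, Real.log_pow]
      exact_mod_cast h1
    calc |β| ^ (n + 1) ≤ |β| ^ n := pow_le_pow_of_le_one hpos.le hβ.le n.le_succ
      _ ≤ h ^ 4 := h2
      _ ≤ h ^ 3 := pow_le_pow_of_le_one hh.le hh1.le (by norm_num)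

theorem TameField.norm_flow_sub_trajectory_le (hv : TameField v v' B) (hP : ∀ z, ‖P z‖ ≤ ‖z‖)
    (hQ : ∀ z, ‖Q z‖ ≤ ‖z‖) {β : ℝ} (hβ : |β| < 1) {K T : ℝ} (hK : 0 ≤ K) (hT : 0 ≤ T) :
    ∃ C, ∀ h : ℝ, 0 < h → h < 1 → ∀ z d : ℕ → V, IsTrajectory v P Q β h z d → ‖d 0‖ ≤ K →
      ∀ n : ℕ, 4 * Real.log h / Real.log |β| ≤ n → (n + 1) * h ≤ T → ∀ ζ : ℝ → V,
        (∀ t ∈ Set.Icc (n * h) ((n + 1) * h), HasDerivWithinAt ζ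
          (modifiedField v v' P Q β h (ζ t)) (Set.Icc (n * h) ((n + 1) * h)) t) →
        ζ (n * h) = z n → ‖ζ ((n + 1) * h) - z (n + 1)‖ ≤ C * h ^ 3 := by
  obtain ⟨R, hR, hr⟩ := hv.norm_displacement_sub_sub_le hP hQ hβ hK hT
  obtain ⟨C, hC, hc⟩ := hv.norm_flow_sub_le hP hQ (1 - β)⁻¹ (-(1 + β) / 2 * (1 - β)⁻¹ ^ 3)
    ((1 - β)⁻¹ ^ 2)
  have h1' : 0 < 1 - β := by linarith [le_abs_self β]
  -- The flow contributes `a² / 2` of its own to the coefficient of `v' v`; this equation is what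
  -- determines the coefficient in `modifiedField`.
  have hb : -(1 + β) / 2 * (1 - β)⁻¹ ^ 3 + (1 - β)⁻¹ ^ 2 / 2 = -β * (1 - β)⁻¹ ^ 3 := by
    field_simp; ring
  rw [hb] at hc
  refine ⟨C + R * 2, fun h hh hh1 z d ht hd n hn hnT ζ hζ hζ0 => ?_⟩
  have e : ((n : ℝ) + 1) * h = n * h + h := by ring
  have k1 := hr h hh hh1 z d ht hd (n + 1) (by push_cast; exact hnT)
  have k2 := hc h hh hh1 (n * h) ζ (by rw [← e]; exact hζ)
  rw [show z (n + 1) - d (n + 1) = z n by rw [ht.step n]; abel] at k1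
  rw [← e, hζ0] at k2
  have k3 := mul_le_mul_of_nonneg_left (abs_pow_succ_le_of_burn_in hβ hh hh1 hn) hR
  rw [ht.step n]
  have k4 := norm_sub_le_of_le k2 k1
  refine le_trans (le_of_eq ?_) (k4.trans (b := _) ?_)
  · congr 1; abel
  · linear_combination k3

theorem TameField.exists_modifiedField_solution [CompleteSpace V] (hv : TameField v v' B)
    (hP : ∀ z, ‖P z‖ ≤ ‖z‖) (hQ : ∀ z, ‖Q z‖ ≤ ‖z‖) (β h : ℝ) {T t₀ : ℝ}
    (ht₀ : t₀ ∈ Set.Icc 0 T) (z₀ : V) :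
    ∃ z : ℝ → V, z t₀ = z₀ ∧ ∀ t ∈ Set.Icc 0 T,
      HasDerivWithinAt z (modifiedField v v' P Q β h (z t)) (Set.Icc 0 T) t := by
  obtain ⟨p, hp⟩ : ∃ p, p = correction v v' P Q (-(1 + β) / 2 * (1 - β)⁻¹ ^ 3) ((1 - β)⁻¹ ^ 2) :=
    ⟨_, rfl⟩
  obtain ⟨M, hM⟩ : ∃ M, ∀ z, ‖p z‖ ≤ M := ⟨_, hp ▸ hv.norm_correction_le hP hQ _ _⟩
  obtain ⟨L, hL⟩ : ∃ L, ∀ z w, ‖p z - p w‖ ≤ L * ‖z - w‖ :=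
    ⟨_, hp ▸ hv.norm_correction_sub_le hP hQ _ _⟩
  refine exists_solution_of_bounded_of_lipschitz (M := |(1 - β)⁻¹| * B + |h| * M)
    (L := |(1 - β)⁻¹| * B + |h| * L) (fun z => ?_) (fun z w => ?_) ht₀ z₀
  · rw [modifiedField, ← hp]
    refine norm_add_le_of_le ?_ ?_ <;> rw [norm_smul, Real.norm_eq_abs]
    · exact mul_le_mul_of_nonneg_left (hv.bound z) (abs_nonneg _)
    · exact mul_le_mul_of_nonneg_left (hM z) (abs_nonneg _)
  · have e : modifiedField v v' P Q β h z - modifiedField v v' P Q β h w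
        = (1 - β)⁻¹ • (v z - v w) + h • (p z - p w) := by
      rw [modifiedField, modifiedField, ← hp]; module
    rw [e, add_mul, mul_assoc, mul_assoc]
    refine norm_add_le_of_le ?_ ?_ <;> rw [norm_smul, Real.norm_eq_abs]
    · exact mul_le_mul_of_nonneg_left (hv.lip z w) (abs_nonneg _)
    · exact mul_le_mul_of_nonneg_left (hL z w) (abs_nonneg _)

end Field

/-! ### From the product space back to pairs. -/

section Product

theorem hasDerivWithinAt_prodMk_iff {E F : Type*}
    [NormedAddCommGroup E] [NormedSpace ℝ E] [NormedAddCommGroup F] [NormedSpace ℝ F]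
    {x : ℝ → E} {y : ℝ → F} {w : E × F} {s : Set ℝ} {t : ℝ} :
    HasDerivWithinAt (fun t => (x t, y t)) w s t ↔
      HasDerivWithinAt x w.1 s t ∧ HasDerivWithinAt y w.2 s t :=
  ⟨fun h => ⟨(ContinuousLinearMap.fst ℝ E F).hasFDerivAt.comp_hasDerivWithinAt t h,
    (ContinuousLinearMap.snd ℝ E F).hasFDerivAt.comp_hasDerivWithinAt t h⟩,
    fun h => h.1.prodMk h.2⟩

variable {E F : Type*}
  [NormedAddCommGroup E] [InnerProductSpace ℝ E] [CompleteSpace E]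
  [NormedAddCommGroup F] [InnerProductSpace ℝ F] [CompleteSpace F]

theorem TameField.locallyCubicClose {v : E × F → E × F} {v' : E × F → E × F →L[ℝ] E × F} {B : ℝ}
    {P Q : E × F →L[ℝ] E × F} (hv : TameField v v' B) (hP : ∀ z, ‖P z‖ ≤ ‖z‖)
    (hQ : ∀ z, ‖Q z‖ ≤ ‖z‖) {β : ℝ} (hβ : |β| < 1) {T : ℝ} (hT : 0 ≤ T)
    {flow : (h : ℝ) → (ℝ → E) → (ℝ → F) → Set ℝ → Prop}
    {discrete : (h : ℝ) → (ℤ → E) → (ℤ → F) → Prop}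
    (hflow : ∀ h x y s, flow h x y s ↔ ∀ t ∈ s, HasDerivWithinAt (fun t => (x t, y t))
      (modifiedField v v' P Q β h (x t, y t)) s t)
    (hdiscrete : ∀ h X Y, discrete h X Y → IsTrajectory v P Q β h (fun n => (X n, Y n))
      (fun n => (X n - X (n - 1), Y n - Y (n - 1)))) :
    LocallyCubicClose flow discrete β T := by
  intro K
  obtain ⟨C, hC⟩ := hv.norm_flow_sub_trajectory_le hP hQ hβ (abs_nonneg K) hT
  refine ⟨C, 1, one_pos, fun h hh hh1 => ⟨fun t₀ ht₀ a b => ?_, ?_⟩⟩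
  · obtain ⟨z, hz0, hz⟩ := hv.exists_modifiedField_solution hP hQ β h ht₀ (a, b)
    exact ⟨fun t => (z t).1, fun t => (z t).2, (hflow _ _ _ _).2 hz,
      congrArg Prod.fst hz0, congrArg Prod.snd hz0⟩
  · intro X Y hXY hX0 hY0 n hn hnT x y hxy hx hy
    -- The product carries the sup norm, so bounds pass between pairs and components without loss.
    have h0 : ‖(X 0 - X (-1), Y 0 - Y (-1))‖ ≤ |K| :=
      max_le (hX0.trans (le_abs_self K)) (hY0.trans (le_abs_self K))
    have := hC h hh hh1 _ _ (hdiscrete h X Y hXY) (by simpa using h0) n hn hnT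
      (fun t => (x t, y t)) ((hflow _ _ _ _).1 hxy) (by simp [hx, hy])
    push_cast at this
    exact ⟨(norm_fst_le _).trans this, (norm_snd_le _).trans this⟩

end Product

/-! ### The descent-ascent field and the gradients of the modified loss. -/

section Saddle

open scoped InnerProductSpace

set_option maxSynthPendingDepth 3

variable {E F : Type*}
  [NormedAddCommGroup E] [InnerProductSpace ℝ E] [CompleteSpace E]
  [NormedAddCommGroup F] [InnerProductSpace ℝ F] [CompleteSpace F]

/-- The Riesz isomorphism of a real Hilbert space as a real linear map. -/
noncomputable def riesz (E : Type*) [NormedAddCommGroup E] [InnerProductSpace ℝ E]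
    [CompleteSpace E] : (E →L[ℝ] ℝ) →L[ℝ] E :=
  LinearMap.mkContinuous
    { toFun := (InnerProductSpace.toDual ℝ E).symm
      map_add' := map_add _
      map_smul' := fun c φ => by simp } 1 (fun φ => by simp)

theorem inner_riesz (φ : E →L[ℝ] ℝ) (ξ : E) : ⟪riesz E φ, ξ⟫_ℝ = φ ξ :=
  InnerProductSpace.toDual_symm_apply

/-- Sends a differential on `E × F` to the descent direction in `E` and the ascent direction
in `F`. -/
noncomputable def saddle (E F : Type*)
    [NormedAddCommGroup E] [InnerProductSpace ℝ E] [CompleteSpace E]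
    [NormedAddCommGroup F] [InnerProductSpace ℝ F] [CompleteSpace F] :
    (E × F →L[ℝ] ℝ) →L[ℝ] E × F :=
  (-(riesz E ∘L (ContinuousLinearMap.compL ℝ E (E × F) ℝ).flip (.inl ℝ E F))).prod
    (riesz F ∘L (ContinuousLinearMap.compL ℝ F (E × F) ℝ).flip (.inr ℝ E F))

theorem inner_saddle_fst (φ : E × F →L[ℝ] ℝ) (ξ : E) : ⟪(saddle E F φ).1, ξ⟫_ℝ = -φ (ξ, 0) := by
  simp [saddle, inner_riesz]

theorem inner_saddle_snd (φ : E × F →L[ℝ] ℝ) (η : F) : ⟪(saddle E F φ).2, η⟫_ℝ = φ (0, η) := by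
  simp [saddle, inner_riesz]

theorem neg_gradX_eq {φ : E → F → ℝ} {φ' : E × F →L[ℝ] ℝ} {z : E × F}
    (h : HasFDerivAt (Function.uncurry φ) φ' z) : -gradX φ z.1 z.2 = (saddle E F φ').1 := by
  have h1 : HasFDerivAt (fun u => φ u z.2) (φ' ∘L .inl ℝ E F) z.1 :=
    HasFDerivAt.comp (f := fun u => (u, z.2)) z.1 h
      (hasFDerivAt_prodMk_left (𝕜 := ℝ) z.1 z.2)
  refine ext_inner_right ℝ fun ξ => ?_
  rw [inner_saddle_fst, inner_neg_left, gradX, inner_gradient_left, h1.fderiv]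
  simp

theorem gradY_eq {φ : E → F → ℝ} {φ' : E × F →L[ℝ] ℝ} {z : E × F}
    (h : HasFDerivAt (Function.uncurry φ) φ' z) : gradY φ z.1 z.2 = (saddle E F φ').2 := by
  have h1 : HasFDerivAt (fun u => φ z.1 u) (φ' ∘L .inr ℝ E F) z.2 :=
    HasFDerivAt.comp (f := fun u => (z.1, u)) z.2 h
      (hasFDerivAt_prodMk_right (𝕜 := ℝ) z.1 z.2)
  refine ext_inner_right ℝ fun ξ => ?_
  rw [inner_saddle_snd, gradY, inner_gradient_left, h1.fderiv]
  simp

/-- The descent-ascent field of `f`. -/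
noncomputable def saddleField (f : E → F → ℝ) (z : E × F) : E × F :=
  saddle E F (fderiv ℝ (Function.uncurry f) z)

/-- The derivative of the descent-ascent field of `f`. -/
noncomputable def saddleFieldDeriv (f : E → F → ℝ) (z : E × F) : E × F →L[ℝ] E × F :=
  saddle E F ∘L fderiv ℝ (fderiv ℝ (Function.uncurry f)) z

variable {f : E → F → ℝ}

theorem saddleField_eq (hf : ContDiff ℝ 4 (Function.uncurry f)) (x : E) (y : F) :
    saddleField f (x, y) = (-gradX f x y, gradY f x y) := by
  have h : HasFDerivAt (Function.uncurry f) _ (x, y) :=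
    (hf.differentiable (by norm_num) (x, y)).hasFDerivAt
  exact Prod.ext (neg_gradX_eq h).symm (gradY_eq h).symm

theorem contDiff_fderiv {V : Type*} [NormedAddCommGroup V] [NormedSpace ℝ V] {g : V → ℝ}
    (hg : ContDiff ℝ 4 g) : ContDiff ℝ 3 (fderiv ℝ g) :=
  hg.fderiv_right (by norm_num)

theorem hasFDerivAt_saddleField (hf : ContDiff ℝ 4 (Function.uncurry f)) (z : E × F) :
    HasFDerivAt (saddleField f) (saddleFieldDeriv f z) z :=
  (saddle E F).hasFDerivAt.comp z
    ((contDiff_fderiv hf).differentiable (by norm_num) z).hasFDerivAt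

/-- The field is a fixed linear map applied to the differential of `f`, so derivative bounds of
orders 1 to 3 bound `v`, `v'` and the Lipschitz constant of `v'`. -/
theorem exists_tameField (hf : ContDiff ℝ 4 (Function.uncurry f))
    (hbdd : ∀ k : ℕ, 1 ≤ k → k ≤ 4 →
      ∃ M : ℝ, ∀ z, ‖iteratedFDeriv ℝ k (Function.uncurry f) z‖ ≤ M) :
    ∃ B, TameField (saddleField f) (saddleFieldDeriv f) B := by
  have hf1 := contDiff_fderiv hf
  have hf2 : ContDiff ℝ 2 (fderiv ℝ (fderiv ℝ (Function.uncurry f))) :=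
    hf1.fderiv_right (m := 2) (by norm_num)
  obtain ⟨M₁, h₁⟩ := hbdd 1 (by norm_num) (by norm_num)
  obtain ⟨M₂, h₂⟩ := hbdd 2 (by norm_num) (by norm_num)
  obtain ⟨M₃, h₃⟩ := hbdd 3 (by norm_num) (by norm_num)
  simp only [← norm_iteratedFDeriv_fderiv, norm_iteratedFDeriv_zero] at h₁ h₂ h₃
  obtain ⟨M, hM₁, hM₂, hM₃⟩ : ∃ M, M₁ ≤ M ∧ M₂ ≤ M ∧ M₃ ≤ M :=
    ⟨max M₁ (max M₂ M₃), by simp⟩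
  have hM0 : 0 ≤ M := (norm_nonneg _).trans ((h₁ 0).trans hM₁)
  have hJ := norm_nonneg (saddle E F)
  have hB : 0 ≤ ‖saddle E F‖ * M := mul_nonneg hJ hM0
  have bound' : ∀ z, ‖saddleFieldDeriv f z‖ ≤ ‖saddle E F‖ * M := fun z =>
    (ContinuousLinearMap.opNorm_comp_le _ _).trans
      (mul_le_mul_of_nonneg_left ((h₂ z).trans hM₂) hJ)
  have lip' : ∀ z w, ‖saddleFieldDeriv f z - saddleFieldDeriv f w‖
      ≤ ‖saddle E F‖ * M * ‖z - w‖ := fun z w => by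
    have h : saddleFieldDeriv f z - saddleFieldDeriv f w = saddle E F ∘L
        (fderiv ℝ (fderiv ℝ (Function.uncurry f)) z - fderiv ℝ (fderiv ℝ (Function.uncurry f)) w) := by
      rw [ContinuousLinearMap.comp_sub]; rfl
    rw [h, mul_assoc]
    refine (ContinuousLinearMap.opNorm_comp_le _ _).trans (mul_le_mul_of_nonneg_left ?_ hJ)
    exact convex_univ.norm_image_sub_le_of_norm_fderiv_le
      (fun x _ => hf2.differentiable (by norm_num) x) (fun x _ => (h₃ x).trans hM₃)
      (Set.mem_univ w) (Set.mem_univ z)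
  refine ⟨‖saddle E F‖ * M, hB, fun z => ?_, bound', fun z w => ?_, lip', fun z d => ?_⟩
  · exact ((saddle E F).le_opNorm _).trans (mul_le_mul_of_nonneg_left ((h₁ z).trans hM₁) hJ)
  · exact convex_univ.norm_image_sub_le_of_norm_hasFDerivWithin_le
      (fun x _ => (hasFDerivAt_saddleField hf x).hasFDerivWithinAt) (fun x _ => bound' x)
      (Set.mem_univ w) (Set.mem_univ z)
  -- On this ball the derivative differs from its value at `z` by at most `B ‖d‖`; the mean value
  -- inequality supplies the second factor `‖d‖`.
  · have h := (convex_closedBall z ‖d‖).norm_image_sub_le_of_norm_hasFDerivWithin_le'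
      (φ := saddleFieldDeriv f z) (C := ‖saddle E F‖ * M * ‖d‖) (x := z) (y := z + d)
      (fun x _ => (hasFDerivAt_saddleField hf x).hasFDerivWithinAt)
      (fun x hx => (lip' x z).trans (mul_le_mul_of_nonneg_left (by
        rwa [mem_closedBall_iff_norm] at hx) hB)) (by simp) (by simp)
    rw [add_sub_cancel_left] at h
    exact h.trans (le_of_eq (by ring))

/-- Symmetry of the second derivative moves `ξ` to the first slot; this is what makes the
corrections gradients. -/
theorem inner_saddleFieldDeriv_fst (hf : ContDiff ℝ 4 (Function.uncurry f)) (z δ : E × F) (ξ : E) :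
    ⟪ξ, (saddleFieldDeriv f z δ).1⟫_ℝ
      = -fderiv ℝ (fderiv ℝ (Function.uncurry f)) z (ξ, 0) δ := by
  have hs : IsSymmSndFDerivAt ℝ (Function.uncurry f) z :=
    hf.contDiffAt.isSymmSndFDerivAt (by simp; norm_num)
  rw [real_inner_comm, hs.eq]
  exact inner_saddle_fst _ _

theorem inner_saddleFieldDeriv_snd (hf : ContDiff ℝ 4 (Function.uncurry f)) (z δ : E × F) (η : F) :
    ⟪η, (saddleFieldDeriv f z δ).2⟫_ℝ
      = fderiv ℝ (fderiv ℝ (Function.uncurry f)) z (0, η) δ := by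
  have hs : IsSymmSndFDerivAt ℝ (Function.uncurry f) z :=
    hf.contDiffAt.isSymmSndFDerivAt (by simp; norm_num)
  rw [real_inner_comm, hs.eq]
  exact inner_saddle_snd _ _

theorem hasFDerivAt_norm_gradX_sq (hf : ContDiff ℝ 4 (Function.uncurry f)) (z : E × F) :
    HasFDerivAt (fun z : E × F => ‖gradX f z.1 z.2‖ ^ 2)
      ((-2 : ℝ) • fderiv ℝ (fderiv ℝ (Function.uncurry f)) z ((saddleField f z).1, 0)) z := by
  have h := ((ContinuousLinearMap.fst ℝ E F).hasFDerivAt.comp z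
    (hasFDerivAt_saddleField hf z)).norm_sq
  have e : (fun z : E × F => ‖gradX f z.1 z.2‖ ^ 2) = fun z => ‖(saddleField f z).1‖ ^ 2 := by
    funext w
    simp [saddleField_eq hf]
  rw [e]
  refine h.congr_fderiv (ContinuousLinearMap.ext fun δ => ?_)
  simp [inner_saddleFieldDeriv_fst hf]

theorem hasFDerivAt_norm_gradY_sq (hf : ContDiff ℝ 4 (Function.uncurry f)) (z : E × F) :
    HasFDerivAt (fun z : E × F => ‖gradY f z.1 z.2‖ ^ 2)
      ((2 : ℝ) • fderiv ℝ (fderiv ℝ (Function.uncurry f)) z (0, (saddleField f z).2)) z := by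
  have h := ((ContinuousLinearMap.snd ℝ E F).hasFDerivAt.comp z
    (hasFDerivAt_saddleField hf z)).norm_sq
  have e : (fun z : E × F => ‖gradY f z.1 z.2‖ ^ 2) = fun z => ‖(saddleField f z).2‖ ^ 2 := by
    funext w
    simp [saddleField_eq hf]
  rw [e]
  refine h.congr_fderiv (ContinuousLinearMap.ext fun δ => ?_)
  simp [inner_saddleFieldDeriv_snd hf]

/-- The opposite signs in the loss and in the field cancel, so the two squared norms combine into
one second derivative applied to the whole of `saddleField f z`. -/
theorem hasFDerivAt_modifiedLoss (hf : ContDiff ℝ 4 (Function.uncurry f)) (β h : ℝ) (z : E × F) :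
    HasFDerivAt (Function.uncurry (modifiedLoss f β h))
      ((1 / (1 - β)) • fderiv ℝ (Function.uncurry f) z
        + (-(2 * (h * (1 + β) / (4 * (1 - β) ^ 3)))) •
          fderiv ℝ (fderiv ℝ (Function.uncurry f)) z (saddleField f z)) z := by
  have h0 := (hf.differentiable (by norm_num) z).hasFDerivAt.const_mul (1 / (1 - β))
  have h1 := ((hasFDerivAt_norm_gradX_sq hf z).sub (hasFDerivAt_norm_gradY_sq hf z)).const_mul
    (h * (1 + β) / (4 * (1 - β) ^ 3))
  refine (h0.add h1).congr_fderiv ?_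
  have e : saddleField f z = ((saddleField f z).1, 0) + (0, (saddleField f z).2) := by simp
  conv_rhs => rw [e, map_add]
  module

theorem modifiedLoss_grad_eq (hf : ContDiff ℝ 4 (Function.uncurry f)) {β : ℝ} (hβ : 1 - β ≠ 0) (h : ℝ)
    (P : E × F →L[ℝ] E × F) (z : E × F) :
    (-gradX (modifiedLoss f β h) z.1 z.2, gradY (modifiedLoss f β h) z.1 z.2)
      = modifiedField (saddleField f) (saddleFieldDeriv f) P 0 β h z := by
  rw [neg_gradX_eq (hasFDerivAt_modifiedLoss hf β h z), gradY_eq (hasFDerivAt_modifiedLoss hf β h z)]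
  rw [Prod.mk.eta, map_add, map_smul, map_smul]
  simp only [modifiedField, correction, zero_apply, smul_zero, add_zero,
    smul_smul, one_div]
  congr 2
  field_simp
  ring

end Saddle

/-! ### Identification of the four systems. -/

section Models

set_option maxSynthPendingDepth 3

variable {E F : Type*}
  [NormedAddCommGroup E] [InnerProductSpace ℝ E] [CompleteSpace E]
  [NormedAddCommGroup F] [InnerProductSpace ℝ F] [CompleteSpace F] {f : E → F → ℝ}

/-- The projection of `E × F` onto its first factor. -/
def projFst (E F : Type*) [NormedAddCommGroup E] [NormedSpace ℝ E]
    [NormedAddCommGroup F] [NormedSpace ℝ F] : E × F →L[ℝ] E × F :=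
  .inl ℝ E F ∘L .fst ℝ E F

/-- The projection of `E × F` onto its second factor. -/
def projSnd (E F : Type*) [NormedAddCommGroup E] [NormedSpace ℝ E]
    [NormedAddCommGroup F] [NormedSpace ℝ F] : E × F →L[ℝ] E × F :=
  .inr ℝ E F ∘L .snd ℝ E F

theorem norm_projFst_le {E F : Type*} [NormedAddCommGroup E] [NormedSpace ℝ E]
    [NormedAddCommGroup F] [NormedSpace ℝ F] (z : E × F) : ‖projFst E F z‖ ≤ ‖z‖ := by
  simp [projFst, Prod.norm_def]

theorem norm_projSnd_le {E F : Type*} [NormedAddCommGroup E] [NormedSpace ℝ E]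
    [NormedAddCommGroup F] [NormedSpace ℝ F] (z : E × F) : ‖projSnd E F z‖ ≤ ‖z‖ := by
  simp [projSnd, Prod.norm_def]

theorem modifiedLoss_grad_alt_eq (hf : ContDiff ℝ 4 (Function.uncurry f)) {β : ℝ} (hβ : 1 - β ≠ 0) (h : ℝ)
    (z : E × F) :
    (-gradX (modifiedLoss f β h) z.1 z.2,
      gradY (fun u v => modifiedLoss f β h u v - h / (2 * (1 - β) ^ 2) * ‖gradX f u v‖ ^ 2) z.1 z.2)
      = modifiedField (saddleField f) (saddleFieldDeriv f) (projFst E F) (projSnd E F) β h z := by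
  have h1 := (hasFDerivAt_modifiedLoss hf β h z).sub
    ((hasFDerivAt_norm_gradX_sq hf z).const_mul (h / (2 * (1 - β) ^ 2)))
  have h2 := modifiedLoss_grad_eq hf hβ h (projFst E F) z
  rw [gradY_eq (hasFDerivAt_modifiedLoss hf β h z)] at h2
  have h3 : gradY (fun u v => modifiedLoss f β h u v - h / (2 * (1 - β) ^ 2) * ‖gradX f u v‖ ^ 2)
      z.1 z.2 = _ := gradY_eq h1
  -- Alternation adds to the simultaneous field only `h a² Q v' P v`, which lives in the second
  -- factor.
  have h4 : modifiedField (saddleField f) (saddleFieldDeriv f) (projFst E F) (projSnd E F) β h z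
      = modifiedField (saddleField f) (saddleFieldDeriv f) (projFst E F) 0 β h z
        + (0, (h * (1 - β)⁻¹ ^ 2) • (saddleFieldDeriv f z ((saddleField f z).1, 0)).2) := by
    simp only [modifiedField, correction, zero_apply, smul_zero, add_zero]
    rw [smul_add, smul_smul h ((1 - β)⁻¹ ^ 2), ← add_assoc]
    congr 1
    ext <;> simp [projFst, projSnd]
  rw [h3, h4, ← h2, map_sub, smul_smul, map_smul]
  refine Prod.ext (add_zero _).symm ?_
  change _ - (h / (2 * (1 - β) ^ 2) * -2) •
    (saddleFieldDeriv f z ((saddleField f z).1, 0)).2 = _ + _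
  rw [sub_eq_add_neg, ← neg_smul]
  congr 2
  field_simp

theorem isTrajectory_of_isSimHB (hf : ContDiff ℝ 4 (Function.uncurry f)) {β h : ℝ} {X : ℤ → E}
    {Y : ℤ → F} (hXY : IsSimHB f β h X Y) (P : E × F →L[ℝ] E × F) :
    IsTrajectory (saddleField f) P 0 β h (fun n => (X n, Y n))
      (fun n => (X n - X (n - 1), Y n - Y (n - 1))) where
  step n := by simp
  momentum n := by
    simp only [saddleField_eq hf, Nat.cast_add, Nat.cast_one, add_sub_cancel_right,
      zero_apply, add_zero]
    ext
    · simp only [Prod.fst_add, Prod.smul_fst]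
      rw [(hXY n).1]; module
    · simp only [Prod.snd_add, Prod.smul_snd]
      rw [(hXY n).2]; module

theorem isTrajectory_of_isAltHB (hf : ContDiff ℝ 4 (Function.uncurry f)) {β h : ℝ} {X : ℤ → E}
    {Y : ℤ → F} (hXY : IsAltHB f β h X Y) :
    IsTrajectory (saddleField f) (projFst E F) (projSnd E F) β h (fun n => (X n, Y n))
      (fun n => (X n - X (n - 1), Y n - Y (n - 1))) where
  step n := by simp
  momentum n := by
    -- Adding the projected displacement advances `x` alone, giving the point where the second
    -- player evaluates its gradient.
    have e : ((X n, Y n) : E × F) + projFst E F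
        (X ((n + 1 : ℕ) : ℤ) - X (((n + 1 : ℕ) : ℤ) - 1),
          Y ((n + 1 : ℕ) : ℤ) - Y (((n + 1 : ℕ) : ℤ) - 1)) = (X (n + 1), Y n) := by
      simp [projFst]
    rw [e]
    simp only [saddleField_eq hf, Nat.cast_add, Nat.cast_one, add_sub_cancel_right]
    ext
    · simp only [projSnd, Prod.fst_add, Prod.smul_fst, ContinuousLinearMap.comp_apply,
        ContinuousLinearMap.inr_apply, add_zero]
      rw [(hXY n).1]; module
    · simp only [projSnd, Prod.snd_add, Prod.smul_snd, ContinuousLinearMap.comp_apply,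
        ContinuousLinearMap.inr_apply, ContinuousLinearMap.coe_snd', Prod.snd_sub]
      rw [(hXY n).2]; module

theorem isContinuousSimHB_iff (hf : ContDiff ℝ 4 (Function.uncurry f)) {β : ℝ} (hβ : 1 - β ≠ 0)
    (P : E × F →L[ℝ] E × F) (h : ℝ) (x : ℝ → E) (y : ℝ → F) (s : Set ℝ) :
    IsContinuousSimHB f β h x y s ↔ ∀ t ∈ s, HasDerivWithinAt (fun t => (x t, y t))
      (modifiedField (saddleField f) (saddleFieldDeriv f) P 0 β h (x t, y t)) s t := by
  simp only [hasDerivWithinAt_prodMk_iff, ← modifiedLoss_grad_eq hf hβ h P]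
  rfl

theorem isContinuousAltHB_iff (hf : ContDiff ℝ 4 (Function.uncurry f)) {β : ℝ} (hβ : 1 - β ≠ 0)
    (h : ℝ) (x : ℝ → E) (y : ℝ → F) (s : Set ℝ) :
    IsContinuousAltHB f β h x y s ↔ ∀ t ∈ s, HasDerivWithinAt (fun t => (x t, y t))
      (modifiedField (saddleField f) (saddleFieldDeriv f) (projFst E F) (projSnd E F) β h
        (x t, y t)) s t := by
  simp only [hasDerivWithinAt_prodMk_iff, ← modifiedLoss_grad_alt_eq hf hβ h]
  rfl

end Models

end HeavyBall

theorem theorem3p1 {p q : ℕ}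
    (f : EuclideanSpace ℝ (Fin p) → EuclideanSpace ℝ (Fin q) → ℝ)
    (hf : ContDiff ℝ 4 (Function.uncurry f))
    (hbdd : ∀ k : ℕ, 1 ≤ k → k ≤ 4 →
      ∃ M : ℝ, ∀ z, ‖iteratedFDeriv ℝ k (Function.uncurry f) z‖ ≤ M)
    (β : ℝ) (hβ : |β| < 1) (T : ℝ) (hT : 0 < T) :
    HeavyBall.LocallyCubicClose (HeavyBall.IsContinuousSimHB f β) (HeavyBall.IsSimHB f β) β T ∧
    HeavyBall.LocallyCubicClose (HeavyBall.IsContinuousAltHB f β) (HeavyBall.IsAltHB f β) β T := by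
  obtain ⟨B, hB⟩ := HeavyBall.exists_tameField hf hbdd
  have hβ' : 1 - β ≠ 0 := by linarith [le_abs_self β]
  refine ⟨?_, ?_⟩
  · exact hB.locallyCubicClose (P := 0) (Q := 0) (fun z => by simp) (fun z => by simp) hβ hT.le
      (HeavyBall.isContinuousSimHB_iff hf hβ' 0)
      (fun h X Y hXY => HeavyBall.isTrajectory_of_isSimHB hf hXY 0)
  · exact hB.locallyCubicClose HeavyBall.norm_projFst_le HeavyBall.norm_projSnd_le hβ hT.le
      (HeavyBall.isContinuousAltHB_iff hf hβ')
      (fun h X Y hXY => HeavyBall.isTrajectory_of_isAltHB hf hXY)
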